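/- **Model.** Let $V$ be a set of anonymous nodes, each with $\Delta$ ports. A *dynamic graph* is a sequence of undirected simple graphs $G_0,G_1,\dots$ on $V$, with arbitrary changes from each to the next; in each snapshot every edge occupies one port at each of its two endpoints, and a port carries at most one edge (so degrees are at most $\Delta$). A port of $u$ experiences a *disconnection* at the beginning of stage $t+1$ if it carries an edge in $G_t$ and is not joined to the same port of the same node in $G_{t+1}$; a detector then adds it to the set $u.D$, which is reset to $\emptyset$ at the end of each activation of $u$. An algorithm $\mathcal A_{sync}$ consists of guarded actions that compute the new state of a node from its state and from what it pulls through its ports (from each neighbour, its main state and the state of its port on the common edge). In step $i$ of a synchronous execution of $\mathcal A_{sync}$ under $H_0,H_1,\dots$ all nodes simultaneously pull from their neighbours in $H_i$ and run an enabled action (a node without one keeps its state). **The synchronizer $\kappa(\mathcal A_{sync})$.** Besides its $\mathcal A_{sync}$-state and $D$, a node has variables $\mathtt{phase}=0$, $\mathtt{synch}=0$, port sets $I=P=\tilde D=F=\emptyset$ and, for each port $\ell$, $\ell.\mathtt{block}=\ell.\mathtt{ack}=0$ (initial values as shown) and $X(\ell)$, the variables last pulled through $\ell$, among them the label $\mathtt{port}$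 of the neighbour's port (initially arbitrary). Its two actions are as follows. * *Handshake*, with guard $\mathtt{synch}=0$ or $\exists \ell\in P\setminus\tilde D$ with $\ell.\mathtt{block}=0$. If $\mathtt{synch}=0$: pull $X(\ell)$ through every port $\ell\in N(u)$ that carries an edge; put $\tilde D:=\emptyset$; let $I$ be the set of $\ell\in N(u)$ with $X(\ell).\mathtt{phase}>\mathtt{phase}$, or with $X(\ell).\mathtt{phase}=\mathtt{phase}$, $X(\ell).\mathtt{synch}=1$ and ($X(\ell).\mathtt{port}\notin X(\ell).P$ or $X(\ell).\mathtt{port}\in X(\ell).\tilde D\cup X(\ell).D$); put $P:=N(u)\setminus I$ and $\mathtt{synch}:=1$. If instead $\mathtt{synch}=1$: for each $\ell\in P\setminus(\tilde D\cup D)$, pull $X(\ell)$ if $X(\ell).\mathtt{phase}<\mathtt{phase}$ and otherwise pull only $X(\ell).\mathtt{ack}$; then put $\tilde D:=\tilde D\cup D$. In both cases, finally, for each $\ell\in P\setminus\tilde D$ with $X(\ell).\mathtt{phase}=\mathtt{phase}$ and $\ell.\mathtt{block}=0$: if $X(\ell).\mathtt{ack}=1$, set $\mathtt{block}$ to $1$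 both at $\ell$ and at the neighbour's port joined to $\ell$; otherwise set $\ell.\mathtt{ack}:=1$. * *ExecuteSynch*, with guard $\mathtt{synch}=1$ and $\ell.\mathtt{block}=1$ for all $\ell\in P\setminus\tilde D$. Put $F:=\{\ell\in P:\ell.\mathtt{block}=1\}$, run an enabled action of $\mathcal A_{sync}$ (if there is one) with respect to $\{X(\ell):\ell\in F\}$, increase $\mathtt{phase}$ by $1$, and reset $\mathtt{synch}$ and all $\mathtt{ack}$ and $\mathtt{block}$ flags to $0$. In a *semi-synchronous execution* under $\mathcal G_{semi}=(G_0,G_1,\dots)$, in each stage $t=0,1,2,\dots$ a scheduler activates a (possibly empty) set of enabled nodes, and each of them executes an enabled action on the graph $G_t$, all reads of the stage preceding all its writes. The scheduler is *weakly fair* if every continuously enabled node is eventually activated. Node $u$ *ends phase $i$* in the stage in which it executes ExecuteSynch with $\mathtt{phase}=i$. **Theorem (Weak non-triviality).** For every algorithm $\mathcal A_{sync}$, every dynamic graph $\mathcal G_{semi}$ and every semi-synchronous execution of $\kappa(\mathcal A_{sync})$ under $\mathcal G_{semi}$ with a weakly fair scheduler, there are a dynamic graph $\mathcal G_{synch}=(H_0,H_1,\dots)$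 and a synchronous execution of $\mathcal A_{sync}$ under $\mathcal G_{synch}$ from the same initial $\mathcal A_{sync}$-states such that, for every $i\ge 0$, every node ends phase $i$, and its $\mathcal A_{sync}$-state at the end of phase $i$ equals its state at the end of step $i$ of the synchronous execution. -/

import Mathlib

/-- The communication graph of one stage, with the ports that its edges occupy. Every node has the
ports `0, …, Δ - 1`; `peer u ℓ = some (v, m)` says that port `ℓ` of `u` and port `m` of `v` are the
two ends of the edge `uv`, and `peer u ℓ = none` that nothing is connected to port `ℓ` of `u`.
Every edge has exactly one port at each end, so that no node has more than `Δ` neighbours. -/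
structure Snapshot (V : Type*) (Δ : ℕ) where
  graph : SimpleGraph V
  peer : V → Fin Δ → Option (V × Fin Δ)
  adj_iff : ∀ u v, graph.Adj u v ↔ ∃ ℓ m, peer u ℓ = some (v, m)
  peer_symm : ∀ u ℓ v m, peer u ℓ = some (v, m) → peer v m = some (u, ℓ)
  port_unique : ∀ u v ℓ m ℓ₂ m₂, peer u ℓ = some (v, m) → peer u ℓ₂ = some (v, m₂) → ℓ = ℓ₂

/-- A dynamic graph with arbitrary edge dynamics: one snapshot for every stage. -/
abbrev DynamicGraph (V : Type*) (Δ : ℕ) := ℕ → Snapshot V Δ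

namespace Snapshot

variable {V : Type*} {Δ : ℕ}

/-- `N(u)`, as the set of the ports of `u` that carry an edge. -/
def nbrPorts (G : Snapshot V Δ) (u : V) : Finset (Fin Δ) :=
  Finset.univ.filter fun ℓ => (G.peer u ℓ).isSome = true

open Classical in
/-- The ports of `u` that the disconnection detector reports when `G` is replaced by `G₂`: those
whose connection in `G` is gone in `G₂` (even if another connection has taken the port). -/
noncomputable def disconnected (G G₂ : Snapshot V Δ) (u : V) : Finset (Fin Δ) :=
  Finset.univ.filter fun ℓ => (G.peer u ℓ).isSome = true ∧ G₂.peer u ℓ ≠ G.peer u ℓ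

end Snapshot

/-- An anonymous algorithm in the Pull model for nodes with `Δ` ports, given by guarded actions.
`expose s m` is what a neighbour connected to port `m` of a node in state `s` can pull (main state
and state of port `m`). Guards and operations depend on the state of the node and on what it pulled
through its ports; the value at `ℓ` is `none` if `ℓ` has no neighbour. -/
structure SyncAlg (Δ : ℕ) where
  State : Type*
  Info : Type*
  Action : Type*
  expose : State → Fin Δ → Info
  guard : Action → State → (Fin Δ → Option Info) → Prop
  op : Action → State → (Fin Δ → Option Info) → State

namespace SyncAlg

variable {V : Type*} {Δ : ℕ} (A : SyncAlg Δ)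

/-- A node in state `s` that pulled `x` runs one of its enabled actions and reaches `s₂`;
if it has no enabled action its state does not change. -/
def Run (s : A.State) (x : Fin Δ → Option A.Info) (s₂ : A.State) : Prop :=
  (∃ a, A.guard a s x ∧ s₂ = A.op a s x) ∨ ((∀ a, ¬ A.guard a s x) ∧ s₂ = s)

/-- What `u` pulls from its neighbours in the snapshot `H` when the nodes are in the states `σ`. -/
def view (H : Snapshot V Δ) (σ : V → A.State) (u : V) : Fin Δ → Option A.Info :=
  fun ℓ => (H.peer u ℓ).map fun p => A.expose (σ p.1) p.2

/-- `σ` is a synchronous execution of `A` under the dynamic graph `H` from the initial states `s₀`: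
in step `i` all nodes act at once on the snapshot `H i`. The states at the start of step `i` are
`σ i`, and those at the end of step `i` are `σ (i + 1)`. -/
structure IsSyncExecution (H : DynamicGraph V Δ) (s₀ : V → A.State) (σ : ℕ → V → A.State) :
    Prop where
  init : σ 0 = s₀
  step : ∀ i u, A.Run (σ i u) (A.view (H i) (σ i) u) (σ (i + 1) u)

end SyncAlg

/-! ### The synchronizer -/

namespace Kappa

/-- The variables pulled from a neighbour: its main state, and the state of its port that carries
the edge. `info` is the part that belongs to the simulated algorithm; `Dtot` is the set of the
ports disconnected during the current phase. -/
structure Pulled (Δ : ℕ) (Info : Type*) where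
  info : Info
  phase : ℕ
  synch : Bool
  I : Finset (Fin Δ)
  P : Finset (Fin Δ)
  D : Finset (Fin Δ)
  Dtot : Finset (Fin Δ)
  F : Finset (Fin Δ)
  block : Bool
  ack : Bool
  port : Fin Δ

/-- The state of a node that runs the synchronizer; `alg` is its state in the simulated
algorithm, and `X ℓ` holds what it last pulled through port `ℓ`. -/
structure NodeState {Δ : ℕ} (A : SyncAlg Δ) where
  alg : A.State
  phase : ℕ
  synch : Bool
  I : Finset (Fin Δ)
  P : Finset (Fin Δ)
  D : Finset (Fin Δ)
  Dtot : Finset (Fin Δ)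
  F : Finset (Fin Δ)
  block : Fin Δ → Bool
  ack : Fin Δ → Bool
  X : Fin Δ → Pulled Δ A.Info

variable {V : Type*} {Δ : ℕ} {A : SyncAlg Δ}

/-- The initial state; the value of `X` is arbitrary before the first pull. -/
structure IsInit (s : A.State) (n : NodeState A) : Prop where
  alg : n.alg = s
  phase : n.phase = 0
  synch : n.synch = false
  I : n.I = ∅
  P : n.P = ∅
  D : n.D = ∅
  Dtot : n.Dtot = ∅
  F : n.F = ∅
  block : ∀ ℓ, n.block ℓ = false
  ack : ∀ ℓ, n.ack ℓ = false

/-- What can be pulled through port `m` of a node in state `n`. -/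
def NodeState.readable (n : NodeState A) (m : Fin Δ) : Pulled Δ A.Info where
  info := A.expose n.alg m
  phase := n.phase
  synch := n.synch
  I := n.I
  P := n.P
  D := n.D
  Dtot := n.Dtot
  F := n.F
  block := n.block m
  ack := n.ack m
  port := m

/-- The result of `Pull(ℓ)` at `u`. -/
def pull (G : Snapshot V Δ) (c : V → NodeState A) (u : V) (ℓ : Fin Δ) :
    Option (Pulled Δ A.Info) :=
  (G.peer u ℓ).map fun p => (c p.1).readable p.2

/-- The guard of the action Handshake. -/
def HandshakeGuard (n : NodeState A) : Prop :=
  n.synch = false ∨ ∃ ℓ ∈ n.P \ n.Dtot, n.block ℓ = false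

/-- The guard of the action ExecuteSynch. -/
def ExecuteGuard (n : NodeState A) : Prop :=
  n.synch = true ∧ ∀ ℓ ∈ n.P \ n.Dtot, n.block ℓ = true

def Enabled (n : NodeState A) : Prop :=
  HandshakeGuard n ∨ ExecuteGuard n

/-- The neighbour from which a node in phase `i` pulled `x` is invalid. -/
def Invalid (i : ℕ) (x : Pulled Δ A.Info) : Prop :=
  (x.phase = i ∧ x.synch = true ∧ (x.port ∉ x.P ∨ x.port ∈ x.Dtot ∪ x.D)) ∨ i < x.phase

instance (i : ℕ) (x : Pulled Δ A.Info) : Decidable (Invalid i x) := by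
  unfold Invalid; infer_instance

/-- Handshake, branch `synch = 0`: pull from all neighbours and set up the phase. -/
def startPhase (G : Snapshot V Δ) (c : V → NodeState A) (u : V) : NodeState A :=
  let X := fun ℓ => (pull G c u ℓ).getD ((c u).X ℓ)
  let I := (G.nbrPorts u).filter fun ℓ => Invalid (c u).phase (X ℓ)
  { c u with X := X, Dtot := ∅, I := I, P := G.nbrPorts u \ I, synch := true }

/-- Handshake, branch `synch = 1`: refresh what was pulled through the valid persistent ports. -/
def refresh (G : Snapshot V Δ) (c : V → NodeState A) (u : V) : NodeState A :=
  { c u with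
    X := fun ℓ =>
      if ℓ ∈ (c u).P \ ((c u).Dtot ∪ (c u).D) then
        let x := (pull G c u ℓ).getD ((c u).X ℓ)
        if ((c u).X ℓ).phase < (c u).phase then x else { (c u).X ℓ with ack := x.ack }
      else (c u).X ℓ
    Dtot := (c u).Dtot ∪ (c u).D }

/-- The state of `u` before the final loop of Handshake. -/
def prepare (G : Snapshot V Δ) (c : V → NodeState A) (u : V) : NodeState A :=
  if (c u).synch = false then startPhase G c u else refresh G c u

/-- The ports that the final loop of Handshake goes through, in the state `n`. -/
def loopPorts (n : NodeState A) : Finset (Fin Δ) :=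
  (n.P \ n.Dtot).filter fun ℓ => (n.X ℓ).phase = n.phase ∧ n.block ℓ = false

/-- The ports `ℓ` on which `u` performs `Block(ℓ)` when it executes Handshake. -/
def blockPorts (G : Snapshot V Δ) (c : V → NodeState A) (u : V) : Finset (Fin Δ) :=
  (loopPorts (prepare G c u)).filter fun ℓ => ((prepare G c u).X ℓ).ack = true

/-- The local effect at `u` of executing Handshake; `D` is reset at the end of the activation. -/
def handshake (G : Snapshot V Δ) (c : V → NodeState A) (u : V) : NodeState A :=
  let n := prepare G c u
  { n with
    block := fun ℓ => n.block ℓ || decide (ℓ ∈ blockPorts G c u)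
    ack := fun ℓ => n.ack ℓ || decide (ℓ ∈ loopPorts n \ blockPorts G c u)
    D := ∅ }

/-- The set `F` computed by ExecuteSynch. -/
def finalPorts (n : NodeState A) : Finset (Fin Δ) :=
  n.P.filter fun ℓ => n.block ℓ = true

/-- The information with respect to which ExecuteSynch runs the simulated algorithm. -/
def simView (n : NodeState A) : Fin Δ → Option A.Info :=
  fun ℓ => if ℓ ∈ finalPorts n then some (n.X ℓ).info else none

/-- The local effect of ExecuteSynch in the state `n`, if the simulated algorithm moves to `s`. -/
def execute (n : NodeState A) (s : A.State) : NodeState A :=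
  { n with
    alg := s
    F := finalPorts n
    phase := n.phase + 1
    synch := false
    ack := fun _ => false
    block := fun _ => false
    D := ∅ }

/-- `n` is a possible state of `u` after its own computation in a stage with communication graph
`G`, set of activated nodes `S` and node states `c` at its start. All reads of a stage precede all
its writes, so that they see the states `c`. -/
def LocalStep (G : Snapshot V Δ) (S : Set V) (c : V → NodeState A) (u : V) (n : NodeState A) :
    Prop :=
  (u ∉ S ∧ n = c u) ∨
  (u ∈ S ∧ HandshakeGuard (c u) ∧ n = handshake G c u) ∨
  (u ∈ S ∧ ExecuteGuard (c u) ∧ ∃ s, A.Run (c u).alg (simView (c u)) s ∧ n = execute (c u) s)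

/-- In the stage, the neighbour of `u` at port `ℓ` writes 1 to the register `block` of `ℓ`. -/
def BlockedByNeighbor (G : Snapshot V Δ) (S : Set V) (c : V → NodeState A) (u : V) (ℓ : Fin Δ) :
    Prop :=
  ∃ v m, G.peer u ℓ = some (v, m) ∧ v ∈ S ∧ HandshakeGuard (c v) ∧ m ∈ blockPorts G c v

open Classical in
/-- The state of `u` at the start of the next stage: after its own computation, which led to `n`,
the writes of the neighbours to the `block` registers of `u`, and the change of the communication
graph from `G` to `G₂`, which the disconnection detector records in `D`. -/
noncomputable def settle (G G₂ : Snapshot V Δ) (S : Set V) (c : V → NodeState A) (u : V)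
    (n : NodeState A) : NodeState A :=
  { n with
    block := fun ℓ => n.block ℓ || decide (BlockedByNeighbor G S c u ℓ)
    D := n.D ∪ G.disconnected G₂ u }

/-- `c` is a semi-synchronous execution of the synchronizer applied to `A`, under the dynamic graph
`G`, from the initial states `s₀` of `A`, in which the scheduler activates the set `S t` of nodes in
stage `t`. The node states at the start of stage `t`, with `D` already recording the disconnections
at the beginning of stage `t`, are `c t`. -/
structure IsSemiExecution (A : SyncAlg Δ) (G : DynamicGraph V Δ) (s₀ : V → A.State)
    (S : ℕ → Set V) (c : ℕ → V → NodeState A) : Prop where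
  init : ∀ u, IsInit (s₀ u) (c 0 u)
  enabled : ∀ t, ∀ u ∈ S t, Enabled (c t u)
  step : ∀ t u, ∃ n, LocalStep (G t) (S t) (c t) u n ∧
    c (t + 1) u = settle (G t) (G (t + 1)) (S t) (c t) u n

/-- Every node that is continuously enabled from some stage on is eventually activated. -/
def WeaklyFair (S : ℕ → Set V) (c : ℕ → V → NodeState A) : Prop :=
  ∀ u t, (∀ r, t ≤ r → Enabled (c r u)) → ∃ r, t ≤ r ∧ u ∈ S r

/-- Node `u` ends its phase `i` in stage `t`: it executes ExecuteSynch in phase `i`. -/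
def EndsPhase (S : ℕ → Set V) (c : ℕ → V → NodeState A) (u : V) (i t : ℕ) : Prop :=
  u ∈ S t ∧ ExecuteGuard (c t u) ∧ (c t u).phase = i

end Kappa

/-!
In each phase, the synchronizer agrees with every neighbour on whether the common edge is used,
and the theorem says that these agreements make up a dynamic graph on which the simulated
execution is synchronous.

*Agreement.* Call a port live if it belongs to the set `P` of the phase that its node has started,
and has kept its edge since. The invariant `Kappa.PortInvariant` relates the two ends of the edge
at a live port (`Kappa.Linked`): as long as the edge is not blocked, the neighbour is not ahead,
and if it has started the same phase, then the edge is live at its end, too, and not blocked. As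
`Block(ℓ)` is performed only after the neighbour has set `ack`, which it does only after it has
started the same phase and pulled data of that phase, a block is set at both ends in the same
stage, at a time when neither of the nodes can execute ExecuteSynch (`Kappa.blocks_spec`). So no
block is lost or leaks into the next phase, and data at a blocked port belong to the current
phase. The invariant is preserved by every stage (`Kappa.invariant_succ`).

*Progress.* The guards of the two actions are complementary, so that all nodes are always enabled
and weak fairness activates each of them infinitely often. By induction on `i`, all nodes reach
phase `i`. A node `u` that never left it would wait for some port in `P` that is never
disconnected or blocked; but the neighbour there reaches phase `i` and by the invariant cannot
leave it without blocking the edge, so that two further handshakes, of `u` and then of the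
neighbour, block it (`Kappa.exists_dropped_or_block`). There are finitely many ports, hence `u`
ends phase `i`.

*The synchronous execution.* `H i` consists of the edges blocked in phase `i`, each with the two
ports that it had when its ends started the phase (`Kappa.exists_phaseSnapshot`). The state of a
node in the simulated algorithm depends only on its phase (`Kappa.IsSemiExecution.alg_eq`), so
that what a node has pulled through a blocked port is what it sees in `H i` when all nodes are in
their states of phase `i`.
-/

/-! ### Snapshots, live ports and partners -/

/-- The snapshot with a given connection of ports. Two nodes are adjacent if some of their ports are
joined. -/
def Snapshot.ofPeer {V : Type*} {Δ : ℕ} (q : V → Fin Δ → Option (V × Fin Δ))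
    (hsymm : ∀ u ℓ v m, q u ℓ = some (v, m) → q v m = some (u, ℓ))
    (hne : ∀ u ℓ m, q u ℓ ≠ some (u, m))
    (hunique : ∀ u v ℓ m ℓ₂ m₂, q u ℓ = some (v, m) → q u ℓ₂ = some (v, m₂) → ℓ = ℓ₂) :
    Snapshot V Δ where
  graph :=
    { Adj := fun u v => ∃ ℓ m, q u ℓ = some (v, m)
      symm := ⟨fun u v ⟨ℓ, m, h⟩ => ⟨m, ℓ, hsymm u ℓ v m h⟩⟩
      loopless := ⟨fun u ⟨ℓ, m, h⟩ => hne u ℓ m h⟩ }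
  peer := q
  adj_iff _ _ := Iff.rfl
  peer_symm := hsymm
  port_unique := hunique

namespace Kappa

variable {V : Type*} {Δ : ℕ} {A : SyncAlg Δ}

/-- The guards of the two actions are complementary. -/
theorem not_handshakeGuard_iff (n : NodeState A) : ¬ HandshakeGuard n ↔ ExecuteGuard n := by
  simp [HandshakeGuard, ExecuteGuard]

theorem enabled_all (n : NodeState A) : Enabled n := by
  rw [Enabled, ← not_handshakeGuard_iff]
  exact em _

theorem mem_nbrPorts {G : Snapshot V Δ} {u : V} {ℓ : Fin Δ} :
    ℓ ∈ G.nbrPorts u ↔ ∃ v m, G.peer u ℓ = some (v, m) := by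
  simp [Snapshot.nbrPorts, Option.isSome_iff_exists]

theorem mem_disconnected {G G₂ : Snapshot V Δ} {u v : V} {ℓ m : Fin Δ}
    (h : G.peer u ℓ = some (v, m)) :
    ℓ ∈ G.disconnected G₂ u ↔ G₂.peer u ℓ ≠ some (v, m) := by
  simp [Snapshot.disconnected, h]

/-- Port `ℓ` of a node in state `n` belongs to the phase in progress and has kept its edge since the
start of the phase. -/
def Live (n : NodeState A) (ℓ : Fin Δ) : Prop :=
  n.synch = true ∧ ℓ ∈ n.P ∧ ℓ ∉ n.Dtot ∧ ℓ ∉ n.D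

/-- In the stage, `u` executes Handshake and performs `Block(ℓ)`. -/
def Blocks (G : Snapshot V Δ) (S : Set V) (c : V → NodeState A) (u : V) (ℓ : Fin Δ) : Prop :=
  u ∈ S ∧ HandshakeGuard (c u) ∧ ℓ ∈ blockPorts G c u

theorem blockedByNeighbor_iff {G : Snapshot V Δ} {S : Set V} {c : V → NodeState A} {u v : V}
    {ℓ m : Fin Δ} (h : G.peer u ℓ = some (v, m)) :
    BlockedByNeighbor G S c u ℓ ↔ Blocks G S c v m := by
  constructor
  · rintro ⟨w, k, hw, h1⟩
    rw [h] at hw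
    cases hw
    exact h1
  · rintro h1
    exact ⟨v, m, h, h1⟩

open Classical in
/-- The connections that the ports of `u` had when `u` last started a phase before stage `t`. This
is no variable of the algorithm; it remembers the neighbour for ports that are disconnected later in
the phase. Before the first start the value is irrelevant, and taken from `G 0`. -/
noncomputable def partner (G : DynamicGraph V Δ) (S : ℕ → Set V) (c : ℕ → V → NodeState A) :
    ℕ → V → Fin Δ → Option (V × Fin Δ)
  | 0, u => (G 0).peer u
  | t + 1, u => if u ∈ S t ∧ (c t u).synch = false then (G t).peer u else partner G S c t u

theorem exists_partner_eq (G : DynamicGraph V Δ) (S : ℕ → Set V) (c : ℕ → V → NodeState A)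
    (t : ℕ) (u : V) : ∃ r, partner G S c t u = (G r).peer u := by
  induction t with
  | zero => exact ⟨0, rfl⟩
  | succ t ih =>
    rw [partner]
    split_ifs
    exacts [⟨t, rfl⟩, ih]

variable {G : DynamicGraph V Δ} {s₀ : V → A.State} {S : ℕ → Set V} {c : ℕ → V → NodeState A}

/-! ### The effect of a stage on a node -/

theorem IsSemiExecution.settle_cases (h : IsSemiExecution A G s₀ S c) (t : ℕ) (u : V) :
    (u ∉ S t ∧ c (t + 1) u = settle (G t) (G (t + 1)) (S t) (c t) u (c t u)) ∨
    (u ∈ S t ∧ (c t u).synch = false ∧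
      c (t + 1) u = settle (G t) (G (t + 1)) (S t) (c t) u (handshake (G t) (c t) u)) ∨
    (u ∈ S t ∧ (c t u).synch = true ∧ HandshakeGuard (c t u) ∧
      c (t + 1) u = settle (G t) (G (t + 1)) (S t) (c t) u (handshake (G t) (c t) u)) ∨
    (u ∈ S t ∧ ExecuteGuard (c t u) ∧ ∃ s, A.Run (c t u).alg (simView (c t u)) s ∧
      c (t + 1) u = settle (G t) (G (t + 1)) (S t) (c t) u (execute (c t u) s)) := by
  obtain ⟨n, hn | hn | hn, e⟩ := h.step t u
  · obtain ⟨h1, rfl⟩ := hn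
    exact .inl ⟨h1, e⟩
  · obtain ⟨h1, h2, rfl⟩ := hn
    cases hs : (c t u).synch
    · exact .inr (.inl ⟨h1, rfl, e⟩)
    · exact .inr (.inr (.inl ⟨h1, rfl, h2, e⟩))
  · obtain ⟨h1, h2, s, h3, rfl⟩ := hn
    exact .inr (.inr (.inr ⟨h1, h2, s, h3, e⟩))

/-- What stage `t` does to `u` if `u` is idle or executes Handshake with `synch = 1`. By the field
`X`, the pulled phase and `info` at a port change only if they are older than the phase of `u` and
the port is live. -/
structure Stays (G : DynamicGraph V Δ) (S : ℕ → Set V) (c : ℕ → V → NodeState A) (t : ℕ) (u : V) :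
    Prop where
  alg : (c (t + 1) u).alg = (c t u).alg
  phase : (c (t + 1) u).phase = (c t u).phase
  synch : (c (t + 1) u).synch = (c t u).synch
  P : (c (t + 1) u).P = (c t u).P
  dropped : ∀ ℓ, ℓ ∉ (c (t + 1) u).Dtot ∧ ℓ ∉ (c (t + 1) u).D ↔
    (ℓ ∉ (c t u).Dtot ∧ ℓ ∉ (c t u).D) ∧ ℓ ∉ (G t).disconnected (G (t + 1)) u
  Dtot : (c t u).Dtot ⊆ (c (t + 1) u).Dtot
  X : ∀ ℓ, ((c (t + 1) u).X ℓ).phase = ((c t u).X ℓ).phase ∧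
      ((c (t + 1) u).X ℓ).info = ((c t u).X ℓ).info ∨
    ((c t u).X ℓ).phase < (c t u).phase ∧ Live (c t u) ℓ ∧ ∀ v m, (G t).peer u ℓ = some (v, m) →
      (c (t + 1) u).X ℓ = (c t v).readable m
  ack : ∀ ℓ, (c t u).ack ℓ = true → (c (t + 1) u).ack ℓ = true
  ack_new : ∀ ℓ, (c (t + 1) u).ack ℓ = true → (c t u).ack ℓ = true ∨
    ((c t u).synch = true ∧ ℓ ∈ (c t u).P ∧ ((c (t + 1) u).X ℓ).phase = (c t u).phase)
  block : ∀ ℓ, (c (t + 1) u).block ℓ = true ↔ (c t u).block ℓ = true ∨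
    Blocks (G t) (S t) (c t) u ℓ ∨ BlockedByNeighbor (G t) (S t) (c t) u ℓ
  blocks : ∀ ℓ, Blocks (G t) (S t) (c t) u ℓ →
    (c t u).synch = true ∧ ℓ ∈ (c t u).P ∧ ((c (t + 1) u).X ℓ).phase = (c t u).phase
  partner : partner G S c (t + 1) u = partner G S c t u

/-- What stage `t` does to `u` if `u` starts a phase, by Handshake with `synch = 0`. -/
structure Starts (G : DynamicGraph V Δ) (S : ℕ → Set V) (c : ℕ → V → NodeState A) (t : ℕ) (u : V) :
    Prop where
  mem : u ∈ S t
  synch_eq_false : (c t u).synch = false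
  alg : (c (t + 1) u).alg = (c t u).alg
  phase : (c (t + 1) u).phase = (c t u).phase
  synch : (c (t + 1) u).synch = true
  P : ∀ ℓ, ℓ ∈ (c (t + 1) u).P ↔ ∃ v m, (G t).peer u ℓ = some (v, m) ∧
    ¬ Invalid (c t u).phase ((c t v).readable m)
  Dtot : (c (t + 1) u).Dtot = ∅
  D : (c (t + 1) u).D = (G t).disconnected (G (t + 1)) u
  X : ∀ ℓ v m, (G t).peer u ℓ = some (v, m) → (c (t + 1) u).X ℓ = (c t v).readable m
  ack_new : ∀ ℓ, (c (t + 1) u).ack ℓ = true → (c t u).ack ℓ = true ∨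
    (ℓ ∈ (c (t + 1) u).P ∧ ((c (t + 1) u).X ℓ).phase = (c t u).phase)
  block : ∀ ℓ, (c (t + 1) u).block ℓ = true ↔ (c t u).block ℓ = true ∨
    Blocks (G t) (S t) (c t) u ℓ ∨ BlockedByNeighbor (G t) (S t) (c t) u ℓ
  blocks : ∀ ℓ, Blocks (G t) (S t) (c t) u ℓ →
    ℓ ∈ (c (t + 1) u).P ∧ ((c (t + 1) u).X ℓ).phase = (c t u).phase
  partner : partner G S c (t + 1) u = (G t).peer u

/-- What stage `t` does to `u` if `u` executes ExecuteSynch. -/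
structure Executes (G : DynamicGraph V Δ) (S : ℕ → Set V) (c : ℕ → V → NodeState A) (t : ℕ)
    (u : V) : Prop where
  mem : u ∈ S t
  guard : ExecuteGuard (c t u)
  run : A.Run (c t u).alg (simView (c t u)) (c (t + 1) u).alg
  phase : (c (t + 1) u).phase = (c t u).phase + 1
  synch : (c (t + 1) u).synch = false
  ack : ∀ ℓ, (c (t + 1) u).ack ℓ = false
  block : ∀ ℓ, (c (t + 1) u).block ℓ = true ↔ BlockedByNeighbor (G t) (S t) (c t) u ℓ

theorem settle_block {G G₂ : Snapshot V Δ} {S : Set V} {c : V → NodeState A} {n : NodeState A}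
    {u : V} {ℓ : Fin Δ} :
    (settle G G₂ S c u n).block ℓ = true ↔ n.block ℓ = true ∨ BlockedByNeighbor G S c u ℓ := by
  simp [settle]

theorem handshake_block {G : Snapshot V Δ} {c : V → NodeState A} {u : V} {ℓ : Fin Δ} :
    (handshake G c u).block ℓ = true ↔ (c u).block ℓ = true ∨ ℓ ∈ blockPorts G c u := by
  simp only [handshake, prepare]
  split_ifs <;> simp [startPhase, refresh]

theorem mem_startPhase_P {G G₂ : Snapshot V Δ} {S : Set V} {c : V → NodeState A} {u : V}
    {ℓ : Fin Δ} (hs : (c u).synch = false) :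
    ℓ ∈ (settle G G₂ S c u (handshake G c u)).P ↔
      ∃ v m, G.peer u ℓ = some (v, m) ∧ ¬ Invalid (c u).phase ((c v).readable m) := by
  have key : ℓ ∈ (startPhase G c u).P ↔ ℓ ∈ G.nbrPorts u ∧
      ¬ Invalid (c u).phase ((pull G c u ℓ).getD ((c u).X ℓ)) := by
    simp only [startPhase, Finset.mem_sdiff, Finset.mem_filter]
    tauto
  simp only [settle, handshake, prepare, hs, if_true]
  rw [key, mem_nbrPorts]
  constructor
  · rintro ⟨⟨v, m, hp⟩, h2⟩
    exact ⟨v, m, hp, by simpa [hp, pull] using h2⟩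
  · rintro ⟨v, m, hp, h2⟩
    exact ⟨⟨v, m, hp⟩, by simpa [hp, pull] using h2⟩

theorem mem_loopPorts_of_synch {G : Snapshot V Δ} {c : V → NodeState A} {u v : V} {ℓ m : Fin Δ}
    (hs : (c u).synch = true) (hp : G.peer u ℓ = some (v, m)) :
    ℓ ∈ loopPorts (prepare G c u) ↔ Live (c u) ℓ ∧ (c u).block ℓ = false ∧
      (((c u).X ℓ).phase < (c u).phase ∧ (c v).phase = (c u).phase ∨
        ((c u).X ℓ).phase = (c u).phase) := by
  simp only [loopPorts, prepare, hs, refresh, Live, pull]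
  by_cases h3 : ℓ ∈ (c u).P \ ((c u).Dtot ∪ (c u).D)
  · by_cases h4 : ((c u).X ℓ).phase < (c u).phase
    · have := h4.ne
      simp at h3
      simp [h3, h4, this, hp, NodeState.readable, and_comm]
    · simp at h3
      simp [h3, h4, and_comm]
  · simp at h3 ⊢
    tauto

theorem live_of_mem_loopPorts {G : Snapshot V Δ} {c : V → NodeState A} {u : V} {ℓ : Fin Δ}
    (hs : (c u).synch = true) (h : ℓ ∈ loopPorts (prepare G c u)) : Live (c u) ℓ := by
  simp only [loopPorts, prepare, hs, refresh, Finset.mem_filter, Finset.mem_sdiff,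
    Finset.mem_union, Bool.true_eq_false, if_false] at h
  exact ⟨hs, by tauto⟩

theorem mem_blockPorts_of_synch {G : Snapshot V Δ} {c : V → NodeState A} {u v : V} {ℓ m : Fin Δ}
    (hs : (c u).synch = true) (hp : G.peer u ℓ = some (v, m)) :
    ℓ ∈ blockPorts G c u ↔ ℓ ∈ loopPorts (prepare G c u) ∧ (c v).ack m = true := by
  rw [blockPorts, Finset.mem_filter]
  refine and_congr_right fun h => ?_
  have h3 := ((mem_loopPorts_of_synch hs hp).1 h).1
  simp only [Live] at h3
  simp only [prepare, hs, refresh, pull]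
  by_cases h4 : ((c u).X ℓ).phase < (c u).phase <;> simp [h3, h4, hp, NodeState.readable]

theorem of_mem_blockPorts_of_not_synch {G : Snapshot V Δ} {c : V → NodeState A} {u : V} {ℓ : Fin Δ}
    (hs : (c u).synch = false) (h : ℓ ∈ blockPorts G c u) :
    ∃ v m, G.peer u ℓ = some (v, m) ∧ ¬ Invalid (c u).phase ((c v).readable m) ∧
      (c v).phase = (c u).phase ∧ (c v).ack m = true := by
  simp only [blockPorts, loopPorts, prepare, hs, if_true, Finset.mem_filter, Finset.mem_sdiff] at h
  have hP : ℓ ∈ (settle G G ∅ c u (handshake G c u)).P := by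
    simpa [settle, handshake, prepare, hs] using h.1.1.1
  obtain ⟨v, m, hp, hv⟩ := (mem_startPhase_P hs).1 hP
  refine ⟨v, m, hp, hv, ?_, ?_⟩
  · simpa [startPhase, pull, hp, NodeState.readable] using h.1.2.1
  · simpa [startPhase, pull, hp, NodeState.readable] using h.2

theorem handshake_ack {G : Snapshot V Δ} {c : V → NodeState A} {u : V} {ℓ : Fin Δ}
    (h : ℓ ∈ loopPorts (prepare G c u)) (h2 : ℓ ∉ blockPorts G c u) :
    (handshake G c u).ack ℓ = true := by
  simp [handshake, h, h2]

/-- Every stage is of one of the three kinds for `u`. The first alternative also records what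
Handshake does to an active node: `D` moves to `Dtot`, and the ports of the loop that `u` does
not block get `ack`. -/
theorem IsSemiExecution.step_cases (h : IsSemiExecution A G s₀ S c) (t : ℕ) (u : V) :
    (Stays G S c t u ∧ (u ∈ S t → (c t u).synch = true ∧ HandshakeGuard (c t u) ∧
      (c t u).D ⊆ (c (t + 1) u).Dtot ∧ ∀ ℓ ∈ loopPorts (prepare (G t) (c t) u),
        ℓ ∉ blockPorts (G t) (c t) u → (c (t + 1) u).ack ℓ = true)) ∨
      Starts G S c t u ∨ Executes G S c t u := by
  obtain ⟨h1, e⟩ | ⟨h1, hs, e⟩ | ⟨h1, hs, h2, e⟩ | ⟨h1, h2, s, h3, e⟩ := h.settle_cases t u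
  · refine .inl ⟨?_, fun hu => absurd hu h1⟩
    constructor
    case block =>
      intro ℓ
      rw [e, settle_block]
      simp [Blocks, h1]
    case partner => simp [Kappa.partner, h1]
    case blocks => exact fun ℓ hb => absurd hb.1 h1
    all_goals simp +contextual [e, settle]
    · tauto
  · refine .inr (.inl ?_)
    constructor
    case block =>
      intro ℓ
      rw [e, settle_block, handshake_block]
      simp [Blocks, h1, show HandshakeGuard (c t u) from .inl hs, or_assoc]
    case partner => simp [Kappa.partner, h1, hs]
    case P =>
      intro ℓ
      rw [e]
      exact mem_startPhase_P hs
    case ack_new =>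
      intro ℓ
      simp only [e, settle, handshake, prepare, hs, if_true, loopPorts]
      simp [startPhase]
      tauto
    case blocks =>
      rintro ℓ ⟨-, -, hb⟩
      revert hb
      simp only [e, settle, handshake, prepare, hs, if_true, loopPorts, blockPorts]
      simp [startPhase]
      tauto
    case X =>
      intro ℓ v m hp
      simp [e, settle, handshake, prepare, hs, startPhase, pull, hp]
    all_goals first | assumption | simp [e, settle, handshake, prepare, hs, startPhase]
  · refine .inl ⟨?_, fun _ => ⟨hs, h2, ?_, fun ℓ h3 h4 => ?_⟩⟩
    rotate_left 2
    · rw [e]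
      exact handshake_ack h3 h4
    constructor
    case block =>
      intro ℓ
      rw [e, settle_block, handshake_block]
      simp [Blocks, h1, h2, or_assoc]
    case partner => simp [Kappa.partner, hs]
    case ack_new =>
      intro ℓ
      simp only [e, settle, handshake, prepare, hs, loopPorts]
      simp [refresh]
      tauto
    case blocks =>
      rintro ℓ ⟨-, -, hb⟩
      revert hb
      simp only [e, settle, handshake, prepare, hs, loopPorts, blockPorts]
      simp [refresh]
      tauto
    case X =>
      intro ℓ
      simp only [e, settle, handshake, prepare, hs, refresh, Live, pull]
      by_cases h3 : ℓ ∈ (c t u).P \ ((c t u).Dtot ∪ (c t u).D)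
      · by_cases h4 : ((c t u).X ℓ).phase < (c t u).phase
        · right
          simp at h3
          refine ⟨h4, by simpa using h3, fun v m hp => ?_⟩
          simp [h3, h4, hp]
        · left
          simp at h3
          simp [h3, h4]
      · left
        simp only [h3, if_false, and_self, Bool.true_eq_false]
    all_goals simp +contextual [e, settle, handshake, prepare, hs, refresh]
  · refine .inr (.inr ?_)
    constructor
    case block =>
      intro ℓ
      rw [e, settle_block]
      simp [execute]
    all_goals first | assumption | simp [e, settle, execute, h3]

/-! ### The invariant -/

/-- The relation between a node in state `n` and the neighbour in state `k` that is joined to its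
live port `ℓ` through port `m`: the neighbour is behind; or it is in the same phase but has not
started it; or both have started the phase and keep the edge, with equal `block` flags; or the
neighbour is ahead, which it can be only once the edge is blocked. -/
def Linked (n k : NodeState A) (ℓ m : Fin Δ) : Prop :=
  k.phase < n.phase ∧ n.block ℓ = false ∨
  k.phase = n.phase ∧ k.synch = false ∧ n.block ℓ = false ∨
  k.phase = n.phase ∧ Live k m ∧ k.block m = n.block ℓ ∨
  n.phase < k.phase ∧ n.block ℓ = true

/-- The invariant of port `ℓ` of `u` at the start of stage `t`. The bound on `r` in `X_info` says
that the pulled data are not newer than the present state, so that the neighbour is not behind. -/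
structure PortInvariant (G : DynamicGraph V Δ) (S : ℕ → Set V) (c : ℕ → V → NodeState A)
    (t : ℕ) (u : V) (ℓ : Fin Δ) : Prop where
  exists_partner : (c t u).synch = true → ℓ ∈ (c t u).P → ∃ v m, partner G S c t u ℓ = some (v, m)
  peer : Live (c t u) ℓ → (G t).peer u ℓ = partner G S c t u ℓ
  X_le : (c t u).synch = true → ℓ ∈ (c t u).P → ((c t u).X ℓ).phase ≤ (c t u).phase
  X_info : (c t u).synch = true → ℓ ∈ (c t u).P → ((c t u).X ℓ).phase = (c t u).phase →
    ∀ v m, partner G S c t u ℓ = some (v, m) → ∃ r ≤ t, (c r v).phase = (c t u).phase ∧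
      ((c t u).X ℓ).info = A.expose (c r v).alg m
  ack : (c t u).ack ℓ = true → (c t u).synch = true ∧ ℓ ∈ (c t u).P ∧
    ((c t u).X ℓ).phase = (c t u).phase
  block : (c t u).block ℓ = true → (c t u).synch = true ∧ ℓ ∈ (c t u).P ∧
    ((c t u).X ℓ).phase = (c t u).phase
  linked : Live (c t u) ℓ → ∀ v m, (G t).peer u ℓ = some (v, m) → Linked (c t u) (c t v) ℓ m

theorem invariant_init (h : IsSemiExecution A G s₀ S c) (u : V) (ℓ : Fin Δ) :
    PortInvariant G S c 0 u ℓ := by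
  have h0 := h.init u
  constructor <;> simp [h0.synch, h0.P, h0.ack, h0.block, Live]

theorem IsSemiExecution.phase_le_succ (h : IsSemiExecution A G s₀ S c) (t : ℕ) (u : V) :
    (c t u).phase ≤ (c (t + 1) u).phase := by
  obtain ⟨h1, -⟩ | h1 | h1 := h.step_cases t u
  · exact h1.phase.ge
  · exact h1.phase.ge
  · exact h1.phase.ge.trans' (Nat.le_succ _)

theorem IsSemiExecution.phase_mono (h : IsSemiExecution A G s₀ S c) (u : V) :
    Monotone fun t => (c t u).phase :=
  monotone_nat_of_le_succ fun t => h.phase_le_succ t u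

/-- The simulated state of a node depends only on its phase. -/
theorem IsSemiExecution.alg_eq (h : IsSemiExecution A G s₀ S c) {u : V} {r t : ℕ}
    (hp : (c r u).phase = (c t u).phase) : (c r u).alg = (c t u).alg := by
  wlog hrt : r ≤ t generalizing r t
  · exact (this hp.symm (le_of_not_ge hrt)).symm
  induction t, hrt using Nat.le_induction with
  | base => rfl
  | succ t hrt ih =>
    have h1 := h.phase_mono u hrt
    have h2 := h.phase_le_succ t u
    simp only at h1
    rw [ih (by omega)]
    obtain ⟨h3, -⟩ | h3 | h3 := h.step_cases t u
    · exact h3.alg.symm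
    · exact h3.alg.symm
    · have := h3.phase
      omega

/-- A neighbour that was pulled in the current phase of `u` has reached that phase. -/
theorem phase_le_of_X_phase_eq (h : IsSemiExecution A G s₀ S c) {t : ℕ} {u v : V} {ℓ m : Fin Δ}
    (hu : PortInvariant G S c t u ℓ) (hl : Live (c t u) ℓ) (hp : (G t).peer u ℓ = some (v, m))
    (hX : ((c t u).X ℓ).phase = (c t u).phase) : (c t u).phase ≤ (c t v).phase := by
  obtain ⟨r, hr, h1, -⟩ := hu.X_info hl.1 hl.2.1 hX v m (by rw [← hu.peer hl, hp])
  rw [← h1]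
  exact h.phase_mono v hr

theorem not_invalid {i : ℕ} {n : NodeState A} {m : Fin Δ} (h : ¬ Invalid i (n.readable m)) :
    n.phase ≤ i ∧ (n.phase = i → n.synch = true → Live n m) := by
  simp only [Invalid, NodeState.readable, Finset.mem_union, Live] at h ⊢
  refine ⟨by_contra fun h1 => h (.inr (by omega)), ?_⟩
  tauto

/-- When `u` blocks an edge, the neighbour has started the same phase, has kept the edge, and its
flag `block` is still unset at the start of the stage, so that it cannot execute ExecuteSynch. -/
theorem blocks_spec (h : IsSemiExecution A G s₀ S c) {t : ℕ}
    (hI : ∀ u ℓ, PortInvariant G S c t u ℓ) {u v : V} {ℓ m : Fin Δ}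
    (hp : (G t).peer u ℓ = some (v, m)) (hb : Blocks (G t) (S t) (c t) u ℓ) :
    (c t v).phase = (c t u).phase ∧ Live (c t v) m ∧ (c t v).block m = false ∧
      (c t v).ack m = true := by
  obtain ⟨-, -, hb⟩ := hb
  cases hs : (c t u).synch
  · obtain ⟨v', m', hp', hv, hph, hack⟩ := of_mem_blockPorts_of_not_synch hs hb
    rw [hp] at hp'
    cases hp'
    have hl := (not_invalid hv).2 hph ((hI v m).ack hack).1
    refine ⟨hph, hl, ?_, hack⟩
    have := (hI v m).linked hl u ℓ ((G t).peer_symm _ _ _ _ hp)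
    simp only [Linked, hph, hs, Live] at this
    simpa using this
  · obtain ⟨hb, hack⟩ := (mem_blockPorts_of_synch hs hp).1 hb
    obtain ⟨hl, hbl, hX⟩ := (mem_loopPorts_of_synch hs hp).1 hb
    have hv := ((hI v m).ack hack).1
    have hle : (c t u).phase ≤ (c t v).phase := by
      obtain hX | hX := hX
      · exact hX.2.ge
      · exact phase_le_of_X_phase_eq h (hI u ℓ) hl hp hX
    have := (hI u ℓ).linked hl v m hp
    simp only [Linked, hbl, hv] at this
    obtain this | this | this | this := this
    · omega
    · simp at this
    · exact ⟨this.1, this.2.1, this.2.2, hack⟩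
    · simp at this

/-- A node whose port is blocked by its neighbour neither starts nor ends a phase in that stage,
so that the write hits the phase it is meant for. -/
theorem Blocks.stays (h : IsSemiExecution A G s₀ S c) {t : ℕ}
    (hI : ∀ u ℓ, PortInvariant G S c t u ℓ) {u v : V} {ℓ m : Fin Δ}
    (hp : (G t).peer u ℓ = some (v, m)) (hb : Blocks (G t) (S t) (c t) u ℓ) :
    Stays G S c t v := by
  obtain ⟨-, hl, hbl, -⟩ := blocks_spec h hI hp hb
  obtain ⟨h1, -⟩ | h1 | h1 := h.step_cases t v
  · exact h1
  · have := h1.synch_eq_false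
    simp [hl.1] at this
  · have := h1.guard.2 m (by simp [hl.2])
    simp [hbl] at this

theorem Stays.live_iff {t : ℕ} {u : V} {ℓ : Fin Δ} (hs : Stays G S c t u) :
    Live (c (t + 1) u) ℓ ↔ Live (c t u) ℓ ∧ ℓ ∉ (G t).disconnected (G (t + 1)) u := by
  have := hs.dropped ℓ
  rw [Live, Live, hs.synch, hs.P]
  tauto

theorem Starts.live_iff {t : ℕ} {u : V} {ℓ : Fin Δ} (hs : Starts G S c t u) :
    Live (c (t + 1) u) ℓ ↔ (∃ v m, (G t).peer u ℓ = some (v, m) ∧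
      ¬ Invalid (c t u).phase ((c t v).readable m)) ∧ ℓ ∉ (G t).disconnected (G (t + 1)) u := by
  rw [Live, hs.synch, hs.P, hs.Dtot, hs.D]
  simp

theorem exists_peer_of_live {t : ℕ} {u : V} {ℓ : Fin Δ} (hu : PortInvariant G S c t u ℓ)
    (hl : Live (c t u) ℓ) : ∃ v m, (G t).peer u ℓ = some (v, m) := by
  rw [hu.peer hl]
  exact hu.exists_partner hl.1 hl.2.1

theorem exists_peer_of_blocks {t : ℕ} {u : V} {ℓ : Fin Δ} (hu : PortInvariant G S c t u ℓ)
    (hb : Blocks (G t) (S t) (c t) u ℓ) : ∃ v m, (G t).peer u ℓ = some (v, m) := by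
  cases hs : (c t u).synch
  · obtain ⟨v, m, hp, -⟩ := of_mem_blockPorts_of_not_synch hs hb.2.2
    exact ⟨v, m, hp⟩
  · exact exists_peer_of_live hu (live_of_mem_loopPorts hs (Finset.mem_filter.1 hb.2.2).1)

theorem stays_of_blockedByNeighbor (h : IsSemiExecution A G s₀ S c) {t : ℕ}
    (hI : ∀ u ℓ, PortInvariant G S c t u ℓ) {u : V} {ℓ : Fin Δ}
    (hb : BlockedByNeighbor (G t) (S t) (c t) u ℓ) : Stays G S c t u ∧ (c t u).ack ℓ = true := by
  obtain ⟨v, m, hp, hb⟩ := hb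
  have hp' := (G t).peer_symm _ _ _ _ hp
  exact ⟨Blocks.stays h hI hp' hb, (blocks_spec h hI hp' hb).2.2.2⟩

/-- An edge that is kept at one end is kept at the other. -/
theorem peer_of_succ {G G₂ : Snapshot V Δ} {u v : V} {ℓ m : Fin Δ} {p : V × Fin Δ}
    (h : G.peer u ℓ = some p) (hd : ℓ ∉ G.disconnected G₂ u)
    (hp : G₂.peer u ℓ = some (v, m)) :
    G.peer u ℓ = some (v, m) ∧ m ∉ G.disconnected G₂ v := by
  obtain ⟨v', m'⟩ := p
  rw [mem_disconnected h, not_not, hp] at hd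
  cases hd
  refine ⟨h, ?_⟩
  rw [mem_disconnected (G.peer_symm _ _ _ _ h), not_not]
  exact G₂.peer_symm _ _ _ _ hp

theorem not_invalid_of_live {n : NodeState A} {m : Fin Δ} (h : n.synch = true → Live n m) :
    ¬ Invalid n.phase (n.readable m) := by
  simp only [Invalid, NodeState.readable, Finset.mem_union, Live] at h ⊢
  simp
  tauto

/-- If `ℓ` is live at `u` after a stage, then the relation `Linked` held at the start of the stage
already; if `u` starts its phase in this stage, because the neighbour passed the test for
validity. -/
theorem linked_before (h : IsSemiExecution A G s₀ S c) {t : ℕ}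
    (hI : ∀ u ℓ, PortInvariant G S c t u ℓ) {u v : V} {ℓ m : Fin Δ}
    (hl : Live (c (t + 1) u) ℓ) (hp : (G (t + 1)).peer u ℓ = some (v, m)) :
    ((G t).peer u ℓ = some (v, m) ∧ m ∉ (G t).disconnected (G (t + 1)) v) ∧
    (c (t + 1) u).phase = (c t u).phase ∧ ((c t u).synch = true → Live (c t u) ℓ) ∧
    Linked (c t u) (c t v) ℓ m ∧
    ((c (t + 1) u).block ℓ = true ↔ (c t u).block ℓ = true ∨
      Blocks (G t) (S t) (c t) u ℓ ∨ Blocks (G t) (S t) (c t) v m) := by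
  obtain ⟨hu, -⟩ | hu | hu := h.step_cases t u
  · obtain ⟨hl, hd⟩ := hu.live_iff.1 hl
    obtain ⟨v', m', hq⟩ := exists_peer_of_live (hI u ℓ) hl
    have hpt := peer_of_succ hq hd hp
    refine ⟨hpt, hu.phase, fun _ => hl, (hI u ℓ).linked hl v m hpt.1, ?_⟩
    rw [← blockedByNeighbor_iff hpt.1]
    exact hu.block ℓ
  · obtain ⟨⟨v', m', hq, hv⟩, hd⟩ := hu.live_iff.1 hl
    have hpt := peer_of_succ hq hd hp
    rw [hpt.1] at hq
    cases hq
    have hs := hu.synch_eq_false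
    have hb : (c t u).block ℓ = false := by
      by_contra hb
      have := (hI u ℓ).block (by simpa using hb)
      simp [hs] at this
    refine ⟨hpt, hu.phase, by simp [hs], ?_, ?_⟩
    · obtain ⟨hle, hlive⟩ := not_invalid hv
      obtain hlt | heq := hle.lt_or_eq
      · exact .inl ⟨hlt, hb⟩
      · cases hsv : (c t v).synch
        · exact .inr (.inl ⟨heq, hsv, hb⟩)
        · have hlv := hlive heq hsv
          have := (hI v m).linked hlv u ℓ ((G t).peer_symm _ _ _ _ hpt.1)
          simp only [Linked, heq, hs, Live] at this
          exact .inr (.inr (.inl ⟨heq, hlv, by simpa [hb] using this⟩))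
    · rw [← blockedByNeighbor_iff hpt.1]
      exact hu.block ℓ
  · have := hl.1
    simp [hu.synch] at this

theorem linked_succ (h : IsSemiExecution A G s₀ S c) {t : ℕ}
    (hI : ∀ u ℓ, PortInvariant G S c t u ℓ) {u v : V} {ℓ m : Fin Δ}
    (hl : Live (c (t + 1) u) ℓ) (hp : (G (t + 1)).peer u ℓ = some (v, m)) :
    Linked (c (t + 1) u) (c (t + 1) v) ℓ m := by
  obtain ⟨⟨hp, hd⟩, hph, hlu, hlink, hbu⟩ := linked_before h hI hl hp
  have hp' := (G t).peer_symm _ _ _ _ hp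
  have hBu : Blocks (G t) (S t) (c t) u ℓ → (c t v).phase = (c t u).phase ∧ Live (c t v) m :=
    fun hb => ⟨(blocks_spec h hI hp hb).1, (blocks_spec h hI hp hb).2.1⟩
  have hBv : Blocks (G t) (S t) (c t) v m → (c t v).phase = (c t u).phase :=
    fun hb => (blocks_spec h hI hp' hb).1.symm
  rw [Linked, hph, ← Bool.not_eq_true, hbu]
  obtain ⟨hv, hvS⟩ | hv | hv := h.step_cases t v
  · -- `v` is idle or goes on with its handshakes
    rw [hv.phase, hv.synch, hv.live_iff, Bool.eq_iff_iff (a := (c (t + 1) v).block m),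
      hbu, hv.block, blockedByNeighbor_iff hp']
    have hSv : Blocks (G t) (S t) (c t) v m → (c t v).synch = true := fun hb => (hvS hb.1).1
    obtain ⟨h1, h2⟩ | ⟨h1, h2, h3⟩ | ⟨h1, h2, h3⟩ | ⟨h1, h2⟩ := hlink
    · left
      refine ⟨h1, ?_⟩
      rintro (h4 | h4 | h4)
      · simp [h2] at h4
      · exact h1.ne (hBu h4).1
      · exact h1.ne (hBv h4)
    · right; left
      refine ⟨h1, h2, ?_⟩
      rintro (h4 | h4 | h4)
      · simp [h3] at h4
      · have := (hBu h4).2.1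
        simp [h2] at this
      · have := hSv h4
        simp [h2] at this
    · right; right; left
      refine ⟨h1, ⟨h2, hd⟩, ?_⟩
      rw [h3]
      exact or_congr_right or_comm
    · exact .inr (.inr (.inr ⟨h1, .inl h2⟩))
  · -- `v` starts its phase; if it is the phase of `u`, then `u` is valid for `v`
    have hs := hv.synch_eq_false
    have hbm : (c t v).block m = false := by
      by_contra hb
      have := (hI v m).block (by simpa using hb)
      simp [hs] at this
    rw [hv.phase, hv.synch, hv.live_iff, Bool.eq_iff_iff (a := (c (t + 1) v).block m),
      hbu, hv.block, blockedByNeighbor_iff hp']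
    obtain ⟨h1, h2⟩ | ⟨h1, h2, h3⟩ | ⟨h1, h2, h3⟩ | ⟨h1, h2⟩ := hlink
    · left
      refine ⟨h1, ?_⟩
      rintro (h4 | h4 | h4)
      · simp [h2] at h4
      · exact h1.ne (hBu h4).1
      · exact h1.ne (hBv h4)
    · right; right; left
      refine ⟨h1, ⟨⟨u, ℓ, hp', ?_⟩, hd⟩, ?_⟩
      · rw [h1]
        exact not_invalid_of_live hlu
      · rw [hbm, h3]
        exact or_congr_right or_comm
    · have := h2.1
      simp [hs] at this
    · exact .inr (.inr (.inr ⟨h1, .inl h2⟩))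
  · -- `v` ends its phase, so that its unblocked ports are not live
    have hvl : Live (c t v) m → (c t v).block m = true :=
      fun hl => hv.guard.2 m (by simp [hl.2])
    have hnu : ¬ Blocks (G t) (S t) (c t) u ℓ := by
      intro hb
      have hb := blocks_spec h hI hp hb
      have := hvl hb.2.1
      simp [hb.2.2.1] at this
    have hnv : ¬ Blocks (G t) (S t) (c t) v m :=
      fun hb => (not_handshakeGuard_iff _).2 hv.guard hb.2.1
    rw [hv.phase, hv.synch]
    obtain ⟨h1, h2⟩ | ⟨h1, h2, h3⟩ | ⟨h1, h2, h3⟩ | ⟨h1, h2⟩ := hlink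
    · have h3 : ¬ ((c t u).block ℓ = true ∨
        Blocks (G t) (S t) (c t) u ℓ ∨ Blocks (G t) (S t) (c t) v m) := by
        simp [h2, hnu, hnv]
      obtain h4 | h4 := Nat.lt_or_eq_of_le (Nat.succ_le_of_lt h1)
      · exact .inl ⟨h4, h3⟩
      · exact .inr (.inl ⟨h4, rfl, h3⟩)
    · have := hv.guard.1
      simp [h2] at this
    · exact .inr (.inr (.inr ⟨by omega, .inl (h3 ▸ hvl h2)⟩))
    · exact .inr (.inr (.inr ⟨by omega, .inl h2⟩))

theorem invariant_succ (h : IsSemiExecution A G s₀ S c) {t : ℕ}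
    (hI : ∀ u ℓ, PortInvariant G S c t u ℓ) (u : V) (ℓ : Fin Δ) :
    PortInvariant G S c (t + 1) u ℓ := by
  have hlink : Live (c (t + 1) u) ℓ → ∀ v m, (G (t + 1)).peer u ℓ = some (v, m) →
      Linked (c (t + 1) u) (c (t + 1) v) ℓ m := fun hl v m => linked_succ h hI hl
  have hu := hI u ℓ
  obtain ⟨hs, -⟩ | hs | hs := h.step_cases t u
  · have hX : ((c t u).X ℓ).phase = (c t u).phase →
        ((c (t + 1) u).X ℓ).phase = (c t u).phase := by
      intro h1
      obtain ⟨h2, -⟩ | ⟨h2, -⟩ := hs.X ℓ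
      · rw [h2, h1]
      · exact absurd h1 h2.ne
    refine ⟨?_, ?_, ?_, ?_, ?_, ?_, hlink⟩
    · rw [hs.synch, hs.P, hs.partner]
      exact hu.exists_partner
    · rw [hs.live_iff, hs.partner]
      rintro ⟨hl, hd⟩
      obtain ⟨v, m, hp⟩ := exists_peer_of_live hu hl
      rw [mem_disconnected hp, not_not] at hd
      rw [← hu.peer hl, hd, hp]
    · rw [hs.synch, hs.P, hs.phase]
      intro h1 h2
      obtain ⟨h3, -⟩ | ⟨h3, hl, h4⟩ := hs.X ℓ
      · rw [h3]
        exact hu.X_le h1 h2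
      · obtain ⟨v, m, hp⟩ := exists_peer_of_live hu hl
        rw [h4 v m hp]
        -- a neighbour that is ahead is blocked, so that its data are not refreshed
        obtain h5 | h5 | h5 | h5 := hu.linked hl v m hp
        · exact h5.1.le
        · exact h5.1.le
        · exact h5.1.le
        · exact absurd (hu.block h5.2).2.2 h3.ne
    · rw [hs.synch, hs.P, hs.phase, hs.partner]
      intro h1 h2 h3 v m hpv
      obtain ⟨h4, h5⟩ | ⟨-, hl, h4⟩ := hs.X ℓ
      · rw [h4] at h3
        rw [h5]
        obtain ⟨r, hr, h6⟩ := hu.X_info h1 h2 h3 v m hpv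
        exact ⟨r, hr.trans (Nat.le_succ t), h6⟩
      · have hX := h4 v m (by rw [hu.peer hl, hpv])
        rw [hX] at h3 ⊢
        exact ⟨t, Nat.le_succ t, h3, rfl⟩
    · rw [hs.synch, hs.P, hs.phase]
      intro hack
      obtain h1 | h1 := hs.ack_new ℓ hack
      · have h2 := hu.ack h1
        exact ⟨h2.1, h2.2.1, hX h2.2.2⟩
      · exact h1
    · rw [hs.synch, hs.P, hs.phase, hs.block]
      have hold : ((c t u).synch = true ∧ ℓ ∈ (c t u).P ∧ ((c t u).X ℓ).phase = (c t u).phase) →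
          ((c t u).synch = true ∧ ℓ ∈ (c t u).P ∧
            ((c (t + 1) u).X ℓ).phase = (c t u).phase) :=
        fun h2 => ⟨h2.1, h2.2.1, hX h2.2.2⟩
      rintro (h1 | h1 | h1)
      · exact hold (hu.block h1)
      · exact hs.blocks ℓ h1
      · -- the neighbour has seen that `ack` is set at `ℓ`
        exact hold (hu.ack (stays_of_blockedByNeighbor h hI h1).2)
  · refine ⟨?_, ?_, ?_, ?_, ?_, ?_, hlink⟩
    · intro _ hP
      obtain ⟨v, m, hp, -⟩ := (hs.P ℓ).1 hP
      exact ⟨v, m, by rw [hs.partner, hp]⟩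
    · rw [hs.live_iff, hs.partner]
      rintro ⟨⟨v, m, hp, -⟩, hd⟩
      rw [mem_disconnected hp, not_not] at hd
      rw [hd, hp]
    · intro _ hP
      obtain ⟨v, m, hp, hv⟩ := (hs.P ℓ).1 hP
      rw [hs.X ℓ v m hp, hs.phase]
      exact (not_invalid hv).1
    · intro _ _ h1 v m hp
      rw [hs.partner] at hp
      rw [hs.X ℓ v m hp, hs.phase] at h1 ⊢
      exact ⟨t, Nat.le_succ t, h1, rfl⟩
    · intro hack
      rw [hs.phase]
      obtain h1 | h1 := hs.ack_new ℓ hack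
      · have := (hu.ack h1).1
        simp [hs.synch_eq_false] at this
      · exact ⟨hs.synch, h1⟩
    · rw [hs.block, hs.phase]
      rintro (h1 | h1 | h1)
      · have := (hu.block h1).1
        simp [hs.synch_eq_false] at this
      · exact ⟨hs.synch, hs.blocks ℓ h1⟩
      · have := (hu.ack (stays_of_blockedByNeighbor h hI h1).2).1
        simp [hs.synch_eq_false] at this
  · have hsy := hs.synch
    refine ⟨?_, ?_, ?_, ?_, ?_, ?_, hlink⟩
    · simp [hsy]
    · simp [hsy, Live]
    · simp [hsy]
    · simp [hsy]
    · simp [hs.ack]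
    · rw [hs.block]
      intro h1
      have := (stays_of_blockedByNeighbor h hI h1).1.phase
      simp [hs.phase] at this

theorem IsSemiExecution.invariant (h : IsSemiExecution A G s₀ S c) (t : ℕ) (u : V) (ℓ : Fin Δ) :
    PortInvariant G S c t u ℓ := by
  induction t generalizing u ℓ with
  | zero => exact invariant_init h u ℓ
  | succ t ih => exact invariant_succ h ih u ℓ

/-! ### Every node ends every phase -/

theorem WeaklyFair.exists_mem (hfair : WeaklyFair S c) (u : V) (t : ℕ) : ∃ r, t ≤ r ∧ u ∈ S r :=
  hfair u t fun _ _ => enabled_all _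

/-- A node that never ends its phase again starts it and then only repeats Handshake. -/
theorem eventually_stays (h : IsSemiExecution A G s₀ S c) (hfair : WeaklyFair S c) {u : V} {t₀ : ℕ}
    (hne : ∀ t, t₀ ≤ t → ¬ Executes G S c t u) :
    ∃ t₁, t₀ ≤ t₁ ∧ ∀ t, t₁ ≤ t → (c t u).synch = true ∧ Stays G S c t u := by
  have hstays : ∀ t, t₀ ≤ t → (c t u).synch = true → Stays G S c t u := by
    intro t ht hs
    obtain ⟨hu, -⟩ | hu | hu := h.step_cases t u
    · exact hu
    · have := hu.synch_eq_false
      simp [hs] at this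
    · exact absurd hu (hne t ht)
  obtain ⟨r, hr, hur⟩ := hfair.exists_mem u t₀
  have hs : (c (r + 1) u).synch = true := by
    obtain ⟨hu, h1⟩ | hu | hu := h.step_cases r u
    · rw [hu.synch]
      exact (h1 hur).1
    · exact hu.synch
    · exact absurd hu (hne r hr)
  have hsynch : ∀ t, r + 1 ≤ t → (c t u).synch = true := by
    intro t ht
    induction t, ht using Nat.le_induction with
    | base => exact hs
    | succ t ht ih => rw [(hstays t (by omega) ih).synch, ih]
  exact ⟨r + 1, by omega, fun t ht => ⟨hsynch t ht, hstays t (by omega) (hsynch t ht)⟩⟩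

/-- A node that handshakes with a neighbour in the same phase either blocks the edge, or has found
`ack` unset at the neighbour and sets its own. -/
theorem Stays.blocks_or_ack (h : IsSemiExecution A G s₀ S c) {t : ℕ} {u v : V} {ℓ m : Fin Δ}
    (hu : Stays G S c t u) (hmem : u ∈ S t) (hl : Live (c t u) ℓ) (hb : (c t u).block ℓ = false)
    (hp : (G t).peer u ℓ = some (v, m)) (hph : (c t v).phase = (c t u).phase) :
    Blocks (G t) (S t) (c t) u ℓ ∨ (c t v).ack m = false ∧ (c (t + 1) u).ack ℓ = true := by
  have hloop : ℓ ∈ loopPorts (prepare (G t) (c t) u) :=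
    (mem_loopPorts_of_synch hl.1 hp).2
      ⟨hl, hb, ((h.invariant t u ℓ).X_le hl.1 hl.2.1).lt_or_eq.imp_left fun h1 => ⟨h1, hph⟩⟩
  obtain ⟨-, h1⟩ | h1 | h1 := h.step_cases t u
  · obtain ⟨-, hg, -, hack⟩ := h1 hmem
    by_cases hbl : ℓ ∈ blockPorts (G t) (c t) u
    · exact .inl ⟨hmem, hg, hbl⟩
    · refine .inr ⟨?_, hack ℓ hloop hbl⟩
      rw [mem_blockPorts_of_synch hl.1 hp] at hbl
      simpa [hloop] using hbl
  · have := h1.synch_eq_false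
    simp [hl.1] at this
  · have := h1.synch
    simp [hu.synch, hl.1] at this

/-- If all nodes reach phase `i` and `u` stays in it, then each port of `u` in `P` is disconnected
or blocked at some time. Otherwise the neighbour stays in phase `i` as well; the next handshake of
`u` sets `ack`, and the following one of the neighbour blocks the edge. -/
theorem exists_dropped_or_block (h : IsSemiExecution A G s₀ S c) (hfair : WeaklyFair S c) {i : ℕ}
    (hreach : ∀ v, ∃ t, (c t v).phase = i) {u : V} {t₁ : ℕ}
    (hu : ∀ t, t₁ ≤ t → (c t u).synch = true ∧ Stays G S c t u)
    (hi : ∀ t, t₁ ≤ t → (c t u).phase = i) {ℓ : Fin Δ}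
    (hP : ∀ t, t₁ ≤ t → ℓ ∈ (c t u).P) :
    ∃ t, t₁ ≤ t ∧ (ℓ ∈ (c t u).Dtot ∨ (c t u).block ℓ = true) := by
  by_contra! hcon
  have hDtot := fun t ht => (hcon t ht).1
  have hblock : ∀ t, t₁ ≤ t → (c t u).block ℓ = false := by simpa using fun t ht => (hcon t ht).2
  -- a detected disconnection is moved to `Dtot` by the next activation
  have hD : ∀ t, t₁ ≤ t → ℓ ∉ (c t u).D := by
    intro t ht hmem
    have hD' : ∀ r, t ≤ r → ℓ ∈ (c r u).D := by
      intro r hr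
      induction r, hr using Nat.le_induction with
      | base => exact hmem
      | succ r hr ih =>
        by_contra h1
        exact (((hu r (by omega)).2.dropped ℓ).1 ⟨hDtot _ (by omega), h1⟩).1.2 ih
    obtain ⟨r, hr, hur⟩ := hfair.exists_mem u t
    obtain ⟨-, h1⟩ | h1 | h1 := h.step_cases r u
    · exact hDtot (r + 1) (by omega) ((h1 hur).2.2.1 (hD' r hr))
    · have := h1.synch_eq_false
      simp [(hu r (by omega)).1] at this
    · have := h1.synch
      simp [(hu (r + 1) (by omega)).1] at this
  have hlive : ∀ t, t₁ ≤ t → Live (c t u) ℓ := fun t ht =>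
    ⟨(hu t ht).1, hP t ht, hDtot t ht, hD t ht⟩
  obtain ⟨v, m, hp₁⟩ := (h.invariant t₁ u ℓ).exists_partner (hu t₁ le_rfl).1 (hP t₁ le_rfl)
  have hp : ∀ t, t₁ ≤ t → (G t).peer u ℓ = some (v, m) := by
    intro t ht
    rw [(h.invariant t u ℓ).peer (hlive t ht)]
    induction t, ht using Nat.le_induction with
    | base => exact hp₁
    | succ t ht ih => rw [(hu t ht).2.partner, ih]
  have hlink := fun t ht => (h.invariant t u ℓ).linked (hlive t ht) v m (hp t ht)
  simp only [Linked] at hlink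
  -- the neighbour cannot pass `u` on an unblocked edge
  have hvle : ∀ t, t₁ ≤ t → (c t v).phase ≤ i := by
    intro t ht
    have h1 := hlink t ht
    have h2 := hi t ht
    rw [hblock t ht] at h1
    simp only [Bool.false_eq_true, and_false, or_false] at h1
    omega
  obtain ⟨t₂, ht₂⟩ := hreach v
  have hv : ∀ t, max t₁ t₂ ≤ t → (c t v).phase = i := by
    intro t ht
    have h1 : (c t₂ v).phase ≤ (c t v).phase := h.phase_mono v (le_of_max_le_right ht)
    have h2 := hvle t (le_of_max_le_left ht)
    omega
  obtain ⟨t₃, ht₃, hvs⟩ := eventually_stays h hfair (u := v) (t₀ := max t₁ t₂) (by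
    intro t ht hex
    have h1 := hex.phase
    rw [hv t ht, hv (t + 1) (by omega)] at h1
    omega)
  have h13 : t₁ ≤ t₃ := le_of_max_le_left ht₃
  have hboth : ∀ t, t₃ ≤ t → Live (c t v) m ∧ (c t v).block m = false := by
    intro t ht
    have h1 := hlink t (by omega)
    rw [hblock t (by omega), hi t (by omega), hv t (by omega), (hvs t ht).1] at h1
    simpa using h1
  obtain ⟨t₄, ht₄, hu₄⟩ := hfair.exists_mem u t₃
  have hnoblock : ∀ t, t₃ ≤ t → ¬ Blocks (G t) (S t) (c t) u ℓ ∧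
      ¬ Blocks (G t) (S t) (c t) v m := by
    intro t ht
    have h1 := hblock (t + 1) (by omega)
    rw [← Bool.not_eq_true, (hu t (by omega)).2.block ℓ,
      blockedByNeighbor_iff (hp t (by omega))] at h1
    exact ⟨fun h2 => h1 (.inr (.inl h2)), fun h2 => h1 (.inr (.inr h2))⟩
  have hack₄ := (((hu t₄ (by omega)).2.blocks_or_ack h hu₄ (hlive t₄ (by omega))
    (hblock t₄ (by omega)) (hp t₄ (by omega))
    (by rw [hi t₄ (by omega), hv t₄ (by omega)])).resolve_left (hnoblock t₄ ht₄).1).2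
  have hack : ∀ t, t₄ + 1 ≤ t → (c t u).ack ℓ = true := by
    intro t ht
    induction t, ht using Nat.le_induction with
    | base => exact hack₄
    | succ t ht ih => exact (hu t (by omega)).2.ack ℓ ih
  obtain ⟨t₅, ht₅, hv₅⟩ := hfair.exists_mem v (t₄ + 1)
  have h1 := (((hvs t₅ (by omega)).2.blocks_or_ack h hv₅ (hboth t₅ (by omega)).1
    (hboth t₅ (by omega)).2 ((G t₅).peer_symm _ _ _ _ (hp t₅ (by omega)))
    (by rw [hi t₅ (by omega), hv t₅ (by omega)])).resolve_left (hnoblock t₅ (by omega)).2).1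
  simp [hack t₅ ht₅] at h1

theorem exists_executes (h : IsSemiExecution A G s₀ S c) (hfair : WeaklyFair S c) {i : ℕ}
    (hreach : ∀ v, ∃ t, (c t v).phase = i) (u : V) :
    ∃ t, Executes G S c t u ∧ (c t u).phase = i := by
  by_contra! hcon
  obtain ⟨t₀, ht₀⟩ := hreach u
  have hi : ∀ t, t₀ ≤ t → (c t u).phase = i := by
    intro t ht
    induction t, ht using Nat.le_induction with
    | base => exact ht₀
    | succ t ht ih =>
      obtain ⟨h1, -⟩ | h1 | h1 := h.step_cases t u
      · rw [h1.phase, ih]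
      · rw [h1.phase, ih]
      · exact absurd ih (hcon t h1)
  obtain ⟨t₁, ht₁, hu⟩ := eventually_stays h hfair fun t ht h1 => hcon t h1 (hi t ht)
  have hP : ∀ t, t₁ ≤ t → (c t u).P = (c t₁ u).P := by
    intro t ht
    induction t, ht using Nat.le_induction with
    | base => rfl
    | succ t ht ih => rw [(hu t ht).2.P, ih]
  have hdone : ∀ ℓ, ∀ᶠ t in Filter.atTop,
      ℓ ∈ (c t₁ u).P → ℓ ∈ (c t u).Dtot ∨ (c t u).block ℓ = true := by
    intro ℓ
    by_cases hℓ : ℓ ∈ (c t₁ u).P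
    · obtain ⟨t₂, ht₂, h2⟩ := exists_dropped_or_block h hfair hreach hu
        (fun t ht => hi t (by omega)) (ℓ := ℓ) (fun t ht => by rwa [hP t ht])
      filter_upwards [Filter.eventually_ge_atTop t₂] with t ht _
      induction t, ht using Nat.le_induction with
      | base => exact h2
      | succ t ht ih =>
        have h3 := (hu t (by omega)).2
        exact ih.imp (fun h4 => h3.Dtot h4) fun h4 => (h3.block ℓ).2 (.inl h4)
    · simp [hℓ]
  obtain ⟨t₂, ht₂⟩ := Filter.eventually_atTop.1 (Filter.eventually_all.2 hdone)
  obtain ⟨r, hr, hur⟩ := hfair.exists_mem u (max t₁ t₂)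
  have hr₁ := le_of_max_le_left hr
  obtain ⟨-, h1⟩ | h1 | h1 := h.step_cases r u
  · obtain ⟨hs, hg | ⟨ℓ, hℓ, hb⟩, -⟩ := h1 hur
    · simp [hs] at hg
    · rw [Finset.mem_sdiff, hP r hr₁] at hℓ
      have := ht₂ r (le_of_max_le_right hr) ℓ hℓ.1
      simp [hℓ.2, hb] at this
  · have := h1.synch_eq_false
    simp [(hu r hr₁).1] at this
  · exact hcon r h1 (hi r (by omega))

theorem exists_executes_phase (h : IsSemiExecution A G s₀ S c) (hfair : WeaklyFair S c) (i : ℕ)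
    (u : V) : ∃ t, Executes G S c t u ∧ (c t u).phase = i := by
  induction i generalizing u with
  | zero => exact exists_executes h hfair (fun v => ⟨0, (h.init v).phase⟩) u
  | succ i ih =>
    refine exists_executes h hfair (fun v => ?_) u
    obtain ⟨t, hex, rfl⟩ := ih v
    exact ⟨t + 1, hex.phase⟩

/-! ### The snapshots of the synchronous execution -/

theorem Blocks.succ (h : IsSemiExecution A G s₀ S c) {t : ℕ} {u v : V} {ℓ m : Fin Δ}
    (hp : (G t).peer u ℓ = some (v, m)) (hb : Blocks (G t) (S t) (c t) u ℓ) :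
    (c (t + 1) u).phase = (c t u).phase ∧ (c (t + 1) u).block ℓ = true ∧
      partner G S c (t + 1) u ℓ = some (v, m) := by
  obtain ⟨h1, -⟩ | h1 | h1 := h.step_cases t u
  · refine ⟨h1.phase, (h1.block ℓ).2 (.inr (.inl hb)), ?_⟩
    have hl := live_of_mem_loopPorts (h1.blocks ℓ hb).1 (Finset.mem_filter.1 hb.2.2).1
    rw [h1.partner, ← (h.invariant t u ℓ).peer hl, hp]
  · exact ⟨h1.phase, (h1.block ℓ).2 (.inr (.inl hb)), by rw [h1.partner, hp]⟩
  · exact absurd hb.2.1 ((not_handshakeGuard_iff _).2 h1.guard)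

theorem Blocks.succ_peer (h : IsSemiExecution A G s₀ S c) {t : ℕ} {u v : V} {ℓ m : Fin Δ}
    (hp : (G t).peer u ℓ = some (v, m)) (hb : Blocks (G t) (S t) (c t) u ℓ) :
    (c (t + 1) v).phase = (c t u).phase ∧ (c (t + 1) v).block m = true ∧
      partner G S c (t + 1) v m = some (u, ℓ) := by
  have hp' := (G t).peer_symm _ _ _ _ hp
  have h1 := Blocks.stays h (h.invariant t) hp hb
  have h2 := blocks_spec h (h.invariant t) hp hb
  refine ⟨by rw [h1.phase, h2.1], (h1.block m).2 (.inr (.inr ⟨u, ℓ, hp', hb⟩)), ?_⟩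
  rw [h1.partner, ← (h.invariant t v m).peer h2.2.1, hp']

/-- If `u` has a blocked port in some phase, then the partner of that port has a stage of the same
phase in which its end of the edge is blocked, too. -/
theorem exists_block_peer (h : IsSemiExecution A G s₀ S c) {t : ℕ} {u v : V} {ℓ m : Fin Δ}
    (hb : (c t u).block ℓ = true) (hp : partner G S c t u ℓ = some (v, m)) :
    ∃ r, (c r v).phase = (c t u).phase ∧ (c r v).block m = true ∧
      partner G S c r v m = some (u, ℓ) := by
  induction t with
  | zero => simp [(h.init u).block] at hb
  | succ t ih =>
    have key : (c t u).block ℓ = true ∧ Stays G S c t u ∨ Blocks (G t) (S t) (c t) u ℓ ∨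
        BlockedByNeighbor (G t) (S t) (c t) u ℓ := by
      obtain ⟨h1, -⟩ | h1 | h1 := h.step_cases t u
      · obtain h2 | h2 := (h1.block ℓ).1 hb
        · exact .inl ⟨h2, h1⟩
        · exact .inr h2
      · obtain h2 | h2 := (h1.block ℓ).1 hb
        · have := ((h.invariant t u ℓ).block h2).1
          simp [h1.synch_eq_false] at this
        · exact .inr h2
      · exact .inr (.inr ((h1.block ℓ).1 hb))
    obtain ⟨h1, h2⟩ | h1 | ⟨w, k, hw, h1⟩ := key
    · rw [h2.partner] at hp
      rw [h2.phase]
      exact ih h1 hp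
    · obtain ⟨w, k, hw⟩ := exists_peer_of_blocks (h.invariant t u ℓ) h1
      obtain ⟨h2, -, h3⟩ := h1.succ h hw
      rw [hp] at h3
      cases h3
      rw [h2]
      exact ⟨t + 1, h1.succ_peer h hw⟩
    · have hw' := (G t).peer_symm _ _ _ _ hw
      have h1 : Blocks (G t) (S t) (c t) w k := h1
      obtain ⟨h2, -, h3⟩ := h1.succ_peer h hw'
      rw [hp] at h3
      cases h3
      rw [h2, ← (h1.succ h hw').1]
      exact ⟨t + 1, rfl, (h1.succ h hw').2⟩

/-- A port that is blocked at some time of a phase is blocked at the end of the phase. -/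
theorem Executes.block_of_block (h : IsSemiExecution A G s₀ S c) {r t : ℕ} {u : V} {ℓ : Fin Δ}
    {p : V × Fin Δ} (hex : Executes G S c t u) (hph : (c r u).phase = (c t u).phase)
    (hb : (c r u).block ℓ = true) (hp : partner G S c r u ℓ = some p) :
    (c t u).block ℓ = true ∧ partner G S c t u ℓ = some p := by
  have hrt : r ≤ t := by
    by_contra! hlt
    have h1 : (c (t + 1) u).phase ≤ (c r u).phase := h.phase_mono u hlt
    rw [hex.phase] at h1
    omega
  clear hex
  induction t, hrt using Nat.le_induction with
  | base => exact ⟨hb, hp⟩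
  | succ t hrt ih =>
    have h1 : (c r u).phase ≤ (c t u).phase := h.phase_mono u hrt
    have h2 := h.phase_le_succ t u
    have h3 := ih (by omega)
    obtain ⟨h4, -⟩ | h4 | h4 := h.step_cases t u
    · exact ⟨(h4.block ℓ).2 (.inl h3.1), by rw [h4.partner, h3.2]⟩
    · have := ((h.invariant t u ℓ).block h3.1).1
      simp [h4.synch_eq_false] at this
    · have := h4.phase
      omega

/-- If all nodes end phase `i`, `u` doing so in stage `e u`, then the ports that they use in these
stages, joined to their partners, form a snapshot: the `block` flags of the two ends of an edge are
set in the same stage, and two ports of `u` have their partners from a single snapshot of `G`. -/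
theorem exists_phaseSnapshot (h : IsSemiExecution A G s₀ S c) {i : ℕ} {e : V → ℕ}
    (he : ∀ u, Executes G S c (e u) u ∧ (c (e u) u).phase = i) :
    ∃ H : Snapshot V Δ, ∀ u ℓ, H.peer u ℓ =
      if ℓ ∈ finalPorts (c (e u) u) then partner G S c (e u) u ℓ else none := by
  have hfinal : ∀ {u ℓ p}, (if ℓ ∈ finalPorts (c (e u) u) then partner G S c (e u) u ℓ else none)
      = some p ↔ (c (e u) u).block ℓ = true ∧ partner G S c (e u) u ℓ = some p := by
    intro u ℓ p
    have hmem : ℓ ∈ finalPorts (c (e u) u) ↔ (c (e u) u).block ℓ = true := by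
      rw [finalPorts, Finset.mem_filter]
      exact and_iff_right_of_imp fun hb => ((h.invariant _ u ℓ).block hb).2.1
    rw [← hmem]
    simp
  refine ⟨Snapshot.ofPeer (fun u ℓ =>
    if ℓ ∈ finalPorts (c (e u) u) then partner G S c (e u) u ℓ else none) ?_ ?_ ?_,
    fun u ℓ => rfl⟩
  · intro u ℓ v m hq
    obtain ⟨hb, hp⟩ := hfinal.1 hq
    obtain ⟨r, hr, hb', hp'⟩ := exists_block_peer h hb hp
    exact hfinal.2 ((he v).1.block_of_block h (by rw [hr, (he u).2, (he v).2]) hb' hp')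
  · intro u ℓ m hq
    obtain ⟨r, hr⟩ := exists_partner_eq G S c (e u) u
    have hp := (hfinal.1 hq).2
    rw [hr] at hp
    exact (G r).graph.irrefl (((G r).adj_iff u u).2 ⟨ℓ, m, hp⟩)
  · intro u v ℓ m ℓ₂ m₂ hq hq₂
    obtain ⟨r, hr⟩ := exists_partner_eq G S c (e u) u
    have hp := (hfinal.1 hq).2
    have hp₂ := (hfinal.1 hq₂).2
    rw [hr] at hp hp₂
    exact (G r).port_unique u v ℓ m ℓ₂ m₂ hp hp₂

end Kappa

/-- For every weakly fair semi-synchronous execution of the synchronizer there are a dynamic graph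
`H` and a synchronous execution `σ` of the simulated algorithm under `H` such that every node ends
every phase `i`, and its state in the simulated algorithm is then its state in `σ` at the end of
step `i`. -/
theorem mainTheorem2 {V : Type*} {Δ : ℕ} (A : SyncAlg Δ) (s₀ : V → A.State)
    (G : DynamicGraph V Δ) (S : ℕ → Set V) (c : ℕ → V → Kappa.NodeState A)
    (hexec : Kappa.IsSemiExecution A G s₀ S c) (hfair : Kappa.WeaklyFair S c) :
    ∃ (H : DynamicGraph V Δ) (σ : ℕ → V → A.State),
      A.IsSyncExecution H s₀ σ ∧
      ∀ (i : ℕ) (u : V),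
        (∃ t, Kappa.EndsPhase S c u i t) ∧
        ∀ t, Kappa.EndsPhase S c u i t → (c (t + 1) u).alg = σ (i + 1) u := by
  choose e he using Kappa.exists_executes_phase hexec hfair
  choose H hH using fun i => Kappa.exists_phaseSnapshot hexec (he i)
  have hσ : ∀ {t i u}, (c t u).phase = i → (c t u).alg = (c (e i u) u).alg := by
    intro t i u ht
    exact hexec.alg_eq (by rw [ht, (he i u).2])
  refine ⟨H, fun i u => (c (e i u) u).alg, ⟨?_, ?_⟩, fun i u => ⟨⟨e i u, ?_⟩, ?_⟩⟩
  · funext u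
    rw [← hσ (hexec.init u).phase, (hexec.init u).alg]
  · intro i u
    obtain ⟨hex, hph⟩ := he i u
    -- what `u` uses at the end of phase `i` is what it sees in `H i`
    have hview : A.view (H i) (fun u => (c (e i u) u).alg) u = Kappa.simView (c (e i u) u) := by
      funext ℓ
      rw [SyncAlg.view, Kappa.simView, hH]
      split_ifs with hℓ
      · obtain ⟨hP, hb⟩ := Finset.mem_filter.1 hℓ
        have hI := hexec.invariant (e i u) u ℓ
        obtain ⟨v, m, hp⟩ := hI.exists_partner hex.guard.1 hP
        obtain ⟨r, -, hr, hinfo⟩ := hI.X_info hex.guard.1 hP (hI.block hb).2.2 v m hp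
        rw [hp, hinfo, hσ (hr.trans hph)]
        rfl
      · rfl
    have hrun := hex.run
    rw [hσ (hex.phase.trans (by rw [hph]))] at hrun
    simpa only [hview] using hrun
  · exact ⟨(he i u).1.mem, (he i u).1.guard, (he i u).2⟩
  · rintro t ⟨hmem, hguard, hph⟩
    apply hσ
    obtain ⟨-, h1⟩ | h1 | h1 := hexec.step_cases t u
    · exact absurd (h1 hmem).2.1 ((Kappa.not_handshakeGuard_iff _).2 hguard)
    · have := hguard.1
      simp [h1.synch_eq_false] at this
    · rw [h1.phase, hph]
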